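/- A locale $X$ is given by its frame of opens $\mathcal O X$; a map of locales $f\colon X\to Y$ is a frame map $f^{-1}\colon\mathcal O Y\to\mathcal O X$, with right adjoint $f_*$. It is open if $f^{-1}$ has a left adjoint $f_!$ with $f_!(U\wedge f^{-1}(V))=f_!(U)\wedge V$ for all $U\in\mathcal O X$, $V\in\mathcal O Y$. It is strongly dense if $f_*(!_X^{-1}(p))\le{}!_Y^{-1}(p)$ for every truth value $p\in\mathcal O 1$, where $!_X\colon X\to 1$ is the map to the terminal locale. A sublocale $A$ of a locale $Y$ is weakly closed if every strongly dense inclusion $A\subseteq B$ into a sublocale $B$ of $Y$ is an isomorphism. A localic relation on $X$ is a sublocale $r\colon R\rightarrowtail X\times X$; its source and target maps are $s=\mathrm{pr}_1\circ r$ and $t=\mathrm{pr}_2\circ r$. It has open cones if $s$ and $t$ are open. It is a localic equivalence relation if it is reflexive ($\Delta\subseteq R$, where $\Delta$ is the diagonal), symmetric ($R=R^{\mathrm{op}}$, where $R^{\mathrm{op}}$ has source $t$ and target $s$), and transitive ($R\circ R\subseteq R$, where $R\circ R$ is the image of $(s\circ\pi_1,\,t\circ\pi_2)\colon R\times_X R\to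 X\times X$, the pullback being taken over $t$ and $s$, with projections $\pi_1,\pi_2$). The quotient map $q\colon X\to X/R$ is the coequaliser of $s$ and $t$ in the category of locales. **Theorem.** Let $R$ be a weakly closed localic equivalence relation with open cones on a locale $X$. Then $R$ is effective: the quotient map $q\colon X\to X/R$ exists, and $R$ is its kernel pair, that is, the square $q\circ s=q\circ t$ is a pullback in the category of locales. -/

import Mathlib

open CategoryTheory CategoryTheory.Limits

universe u

noncomputable section

/-! ## The coproduct of two frames -/

namespace FrameCoprod

variable {L M N : Type u} [Order.Frame L] [Order.Frame M] [Order.Frame N]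

theorem mem_himp_iff (a b : LowerSet (L × M)) (p : L × M) :
    p ∈ a ⇨ b ↔ ∀ q, q ≤ p → q ∈ a → q ∈ b := by
  rw [← LowerSet.Iic_le, le_himp_iff]
  constructor
  · intro h q hq ha
    exact h ⟨hq, ha⟩
  · intro h q hq
    exact h q hq.1 hq.2

end FrameCoprod

/-- The coproduct `L ⊗ M` of two frames, realised as the frame of those down-closed subsets of
`L × M` which are closed under arbitrary joins in each of the two coordinates.  These subsets form
a sublocale set of the frame of all down-closed subsets. -/
def frameCoprodIdeals (L M : Type u) [Order.Frame L] [Order.Frame M] :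
    Sublocale (LowerSet (L × M)) where
  carrier := {D | (∀ (S : Set L) (y : M), (∀ x ∈ S, (x, y) ∈ D) → (sSup S, y) ∈ D) ∧
    (∀ (x : L) (T : Set M), (∀ y ∈ T, (x, y) ∈ D) → (x, sSup T) ∈ D)}
  sInf_mem' := by
    intro s hs
    constructor
    · intro S y h
      rw [LowerSet.mem_sInf_iff]
      intro D hD
      exact (hs hD).1 S y fun x hx => LowerSet.mem_sInf_iff.1 (h x hx) D hD
    · intro x T h
      rw [LowerSet.mem_sInf_iff]
      intro D hD
      exact (hs hD).2 x T fun y hy => LowerSet.mem_sInf_iff.1 (h y hy) D hD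
  himp_mem' := by
    rintro a b ⟨h1, h2⟩
    constructor
    · intro S y h
      rw [FrameCoprod.mem_himp_iff]
      rintro ⟨v, w⟩ ⟨hv, hw⟩ ha
      have e : v = sSup ((fun x => v ⊓ x) '' S) := by
        rw [sSup_image, ← inf_sSup_eq]; exact (inf_eq_left.2 hv).symm
      rw [e]
      refine h1 _ _ ?_
      rintro _ ⟨x, hx, rfl⟩
      exact (FrameCoprod.mem_himp_iff a b _).1 (h x hx) (v ⊓ x, w) ⟨inf_le_right, hw⟩
        (a.lower (show (v ⊓ x, w) ≤ (v, w) from ⟨inf_le_left, le_rfl⟩) ha)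
    · intro x T h
      rw [FrameCoprod.mem_himp_iff]
      rintro ⟨v, w⟩ ⟨hv, hw⟩ ha
      have e : w = sSup ((fun y => w ⊓ y) '' T) := by
        rw [sSup_image, ← inf_sSup_eq]; exact (inf_eq_left.2 hw).symm
      rw [e]
      refine h2 _ _ ?_
      rintro _ ⟨y, hy, rfl⟩
      exact (FrameCoprod.mem_himp_iff a b _).1 (h y hy) (v, w ⊓ y) ⟨hv, inf_le_right⟩
        (a.lower (show (v, w ⊓ y) ≤ (v, w) from ⟨le_rfl, inf_le_left⟩) ha)

/-- The underlying type of the frame `L ⊗ M`. -/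
abbrev FrameCoprod (L M : Type u) [Order.Frame L] [Order.Frame M] : Type u :=
  frameCoprodIdeals L M

namespace FrameCoprod

variable {L M N : Type u} [Order.Frame L] [Order.Frame M] [Order.Frame N]

/-- The basic rectangle `x ⊗ y`: the least element of `L ⊗ M` which contains the pair `(x, y)`. -/
def rect (x : L) (y : M) : FrameCoprod L M :=
  (frameCoprodIdeals L M).restrict (LowerSet.Iic (x, y))

theorem rect_le_iff (x : L) (y : M) (D : FrameCoprod L M) :
    rect x y ≤ D ↔ (x, y) ∈ D.1 := by
  rw [rect, (frameCoprodIdeals L M).giRestrict.gc.le_iff_le, LowerSet.Iic_le]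

theorem rect_inf_rect (x x' : L) (y y' : M) :
    rect x y ⊓ rect x' y' = rect (x ⊓ x') (y ⊓ y') := by
  have e : LowerSet.Iic (x, y) ⊓ LowerSet.Iic (x', y') = LowerSet.Iic (x ⊓ x', y ⊓ y') := by
    rw [← LowerSet.Iic_inf, Prod.mk_inf_mk]
  rw [rect, rect, rect, ← map_inf, e]

theorem rect_sSup_left (S : Set L) (y : M) : rect (sSup S) y = ⨆ x ∈ S, rect x y := by
  apply le_antisymm
  · rw [rect_le_iff]
    refine (⨆ x ∈ S, rect x y : FrameCoprod L M).2.1 S y fun x hx => ?_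
    rw [← rect_le_iff]
    exact le_iSup₂_of_le x hx le_rfl
  · refine iSup₂_le fun x hx => ?_
    rw [rect_le_iff]
    exact (rect (sSup S) y).1.lower (show (x, y) ≤ (sSup S, y) from ⟨le_sSup hx, le_rfl⟩)
      ((rect_le_iff _ _ _).1 le_rfl)

theorem rect_sSup_right (x : L) (T : Set M) : rect x (sSup T) = ⨆ y ∈ T, rect x y := by
  apply le_antisymm
  · rw [rect_le_iff]
    refine (⨆ y ∈ T, rect x y : FrameCoprod L M).2.2 x T fun y hy => ?_
    rw [← rect_le_iff]
    exact le_iSup₂_of_le y hy le_rfl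
  · refine iSup₂_le fun y hy => ?_
    rw [rect_le_iff]
    exact (rect x (sSup T)).1.lower (show (x, y) ≤ (x, sSup T) from ⟨le_rfl, le_sSup hy⟩)
      ((rect_le_iff _ _ _).1 le_rfl)

theorem rect_top_top : rect (⊤ : L) (⊤ : M) = ⊤ := by
  have e : LowerSet.Iic ((⊤ : L), (⊤ : M)) = ⊤ := LowerSet.Iic_top
  rw [rect, e, map_top]

/-- Every element of `L ⊗ M` is the join of the rectangles below it. -/
theorem eq_iSup_rect (D : FrameCoprod L M) : D = ⨆ p ∈ D.1, rect p.1 p.2 := by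
  apply le_antisymm
  · intro p hp
    exact (rect_le_iff p.1 p.2 _).1 (le_iSup₂_of_le (f := fun (p : L × M) (_ : p ∈ D.1) =>
      rect p.1 p.2) p hp le_rfl)
  · exact iSup₂_le fun p hp => (rect_le_iff _ _ _).2 hp

/-- The first coproduct injection, `x ↦ x ⊗ ⊤`. -/
def inl : FrameHom L (FrameCoprod L M) where
  toFun x := rect x ⊤
  map_inf' x x' := by rw [rect_inf_rect, inf_idem]
  map_top' := rect_top_top
  map_sSup' S := by rw [rect_sSup_left, sSup_image]

/-- The second coproduct injection, `y ↦ ⊤ ⊗ y`. -/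
def inr : FrameHom M (FrameCoprod L M) where
  toFun y := rect ⊤ y
  map_inf' y y' := by rw [rect_inf_rect, inf_idem]
  map_top' := rect_top_top
  map_sSup' T := by rw [rect_sSup_right, sSup_image]

theorem inl_inf_inr (x : L) (y : M) : inl x ⊓ inr y = rect x y := by
  change rect x ⊤ ⊓ rect ⊤ y = _
  rw [rect_inf_rect, inf_top_eq, top_inf_eq]

/-- The right adjoint of the copair `[h, k]`. -/
def copairAdj (h : FrameHom L N) (k : FrameHom M N) (n : N) : FrameCoprod L M := by
  refine ⟨⟨{p | h p.1 ⊓ k p.2 ≤ n}, ?_⟩, ?_, ?_⟩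
  · intro p q hqp hp
    exact le_trans (inf_le_inf (OrderHomClass.mono h hqp.1) (OrderHomClass.mono k hqp.2)) hp
  · intro S y hS
    change h (sSup S) ⊓ k y ≤ n
    rw [map_sSup, sSup_inf_eq]
    refine iSup₂_le ?_
    rintro _ ⟨x, hx, rfl⟩
    exact hS x hx
  · intro x T hT
    change h x ⊓ k (sSup T) ≤ n
    rw [map_sSup, inf_sSup_eq]
    refine iSup₂_le ?_
    rintro _ ⟨y, hy, rfl⟩
    exact hT y hy

theorem copair_gc (h : FrameHom L N) (k : FrameHom M N) :
    GaloisConnection (fun D : FrameCoprod L M => ⨆ p ∈ D.1, h p.1 ⊓ k p.2) (copairAdj h k) :=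
  fun _ _ => iSup₂_le_iff

/-- The copair `[h, k] : L ⊗ M → N` of two frame maps, with `[h, k] (x ⊗ y) = h x ⊓ k y`. -/
def copair (h : FrameHom L N) (k : FrameHom M N) : FrameHom (FrameCoprod L M) N where
  toFun D := ⨆ p ∈ D.1, h p.1 ⊓ k p.2
  map_inf' D E := by
    apply le_antisymm
    · refine iSup₂_le fun p hp => le_inf ?_ ?_
      · exact le_iSup₂_of_le (f := fun (p : L × M) (_ : p ∈ D.1) => h p.1 ⊓ k p.2) p hp.1 le_rfl
      · exact le_iSup₂_of_le (f := fun (p : L × M) (_ : p ∈ E.1) => h p.1 ⊓ k p.2) p hp.2 le_rfl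
    · rw [iSup₂_inf_eq]
      refine iSup₂_le fun p hp => ?_
      rw [inf_iSup₂_eq]
      refine iSup₂_le fun q hq => ?_
      refine le_iSup₂_of_le (f := fun (p : L × M) (_ : p ∈ (D ⊓ E).1) => h p.1 ⊓ k p.2)
        (p ⊓ q) ⟨D.1.lower inf_le_left hp, E.1.lower inf_le_right hq⟩ ?_
      change _ ≤ h (p.1 ⊓ q.1) ⊓ k (p.2 ⊓ q.2)
      rw [map_inf, map_inf, inf_inf_inf_comm]
  map_top' := by
    refine top_le_iff.1 ?_
    refine le_iSup₂_of_le (f := fun (p : L × M) (_ : p ∈ (⊤ : FrameCoprod L M).1) =>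
      h p.1 ⊓ k p.2) ⊤ ?_ ?_
    · exact (rect_le_iff ⊤ ⊤ ⊤).1 le_top
    · change _ ≤ h ⊤ ⊓ k ⊤
      rw [map_top, map_top, inf_idem]
  map_sSup' S := by
    rw [sSup_image]
    exact (copair_gc h k).l_sSup

theorem copair_rect (h : FrameHom L N) (k : FrameHom M N) (x : L) (y : M) :
    copair h k (rect x y) = h x ⊓ k y := by
  apply le_antisymm
  · exact (copair_gc h k _ _).2 ((rect_le_iff _ _ _).2 (le_refl (h x ⊓ k y)))
  · exact le_iSup₂_of_le (f := fun (p : L × M) (_ : p ∈ (rect x y).1) => h p.1 ⊓ k p.2) (x, y)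
      ((rect_le_iff _ _ _).1 le_rfl) le_rfl

theorem copair_inl (h : FrameHom L N) (k : FrameHom M N) (x : L) :
    copair h k (inl x) = h x := by
  change copair h k (rect x ⊤) = _
  rw [copair_rect, map_top, inf_top_eq]

theorem copair_inr (h : FrameHom L N) (k : FrameHom M N) (y : M) :
    copair h k (inr y) = k y := by
  change copair h k (rect ⊤ y) = _
  rw [copair_rect, map_top, top_inf_eq]

theorem hom_ext {f g : FrameHom (FrameCoprod L M) N} (hl : ∀ x, f (inl x) = g (inl x))
    (hr : ∀ y, f (inr y) = g (inr y)) : f = g := by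
  ext D
  rw [eq_iSup_rect D]
  simp only [map_iSup, ← inl_inf_inr, map_inf, hl, hr]

end FrameCoprod

namespace Locale

/-! ## Maps of locales -/

/-- The frame map `f⁻¹ : 𝒪 Y → 𝒪 X` underlying a map of locales `f : X ⟶ Y`. -/
def inv {X Y : Locale.{u}} (f : X ⟶ Y) : FrameHom Y X :=
  Frm.Hom.hom f.unop

/-- The map of locales given by a frame map in the opposite direction. -/
def ofFrameHom {X Y : Locale.{u}} (h : FrameHom Y X) : X ⟶ Y :=
  Quiver.Hom.op (Frm.ofHom h)

@[simp] theorem inv_ofFrameHom {X Y : Locale.{u}} (h : FrameHom Y X) : inv (ofFrameHom h) = h :=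
  rfl

@[simp] theorem inv_comp {X Y Z : Locale.{u}} (f : X ⟶ Y) (g : Y ⟶ Z) :
    inv (f ≫ g) = (inv f).comp (inv g) :=
  rfl

@[simp] theorem inv_id (X : Locale.{u}) : inv (𝟙 X) = FrameHom.id X :=
  rfl

theorem hom_ext {X Y : Locale.{u}} {f g : X ⟶ Y} (h : ∀ V, inv f V = inv g V) : f = g :=
  Quiver.Hom.unop_inj (Frm.hom_ext (FrameHom.ext h))

/-- The right adjoint `f_*` of `f⁻¹`. -/
def direct {X Y : Locale.{u}} (f : X ⟶ Y) (U : X) : Y :=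
  sSup {V | inv f V ≤ U}

theorem gc_inv_direct {X Y : Locale.{u}} (f : X ⟶ Y) :
    GaloisConnection (inv f) (direct f) := by
  intro V U
  constructor
  · intro h
    exact le_sSup h
  · intro h
    refine (OrderHomClass.mono (inv f) h).trans ?_
    rw [direct, map_sSup]
    exact sSup_le (by rintro _ ⟨W, hW, rfl⟩; exact hW)

/-- A map of locales `f` is open if `f⁻¹` has a left adjoint satisfying Frobenius reciprocity. -/
def IsOpenMap {X Y : Locale.{u}} (f : X ⟶ Y) : Prop :=
  ∃ e : X → Y, GaloisConnection e (inv f) ∧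
    ∀ (U : X) (V : Y), e (U ⊓ inv f V) = e U ⊓ V

/-! ## Sublocales -/

/-- The inclusion map of a sublocale; its frame map sends `U` to the least element of the
sublocale above `U`. -/
def incl {X : Locale.{u}} (S : Sublocale X) : of S ⟶ X :=
  ofFrameHom (X := of S) S.restrict

/-- The frame map of the inclusion map between two sublocales `S ≤ T` of the same locale. -/
def inclusionHom {X : Locale.{u}} {S T : Sublocale X} (h : S ≤ T) : FrameHom T S where
  toFun b := S.restrict b
  map_inf' a b := by rw [Sublocale.coe_inf, map_inf]
  map_top' := map_top S.restrict
  map_sSup' B := by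
    have gc : GaloisConnection (fun b : T => S.restrict (b : X))
        (fun a : S => (⟨a, h a.2⟩ : T)) := fun b a => S.giRestrict.gc (b : X) a
    rw [sSup_image]
    exact gc.l_sSup

/-- The inclusion map between two sublocales `S ≤ T` of the same locale. -/
def inclusion {X : Locale.{u}} {S T : Sublocale X} (h : S ≤ T) : of S ⟶ of T :=
  ofFrameHom (X := of S) (Y := of T) (inclusionHom h)

theorem inclusion_incl {X : Locale.{u}} {S T : Sublocale X} (h : S ≤ T) :
    inclusion h ≫ incl T = incl S := by
  refine hom_ext fun V => ?_
  change S.restrict (T.restrict V : X) = S.restrict V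
  refine eq_of_forall_ge_iff fun c => ?_
  rw [S.giRestrict.gc.le_iff_le, S.giRestrict.gc.le_iff_le]
  exact T.giRestrict.gc.le_iff_le (b := ⟨c, h c.2⟩)

/-- The image of a map of locales, as a sublocale of the codomain: the elements of the form
`f_* U`, equivalently those fixed by the nucleus `f_* f⁻¹`. -/
def image {X Y : Locale.{u}} (f : X ⟶ Y) : Sublocale Y :=
  Nucleus.toSublocale
    { toFun := fun V => direct f (inv f V)
      map_inf' := fun V W => by rw [map_inf, (gc_inv_direct f).u_inf]
      idempotent' := fun V => by rw [(gc_inv_direct f).l_u_l_eq_l]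
      le_apply' := fun V => (gc_inv_direct f).le_u_l V }

theorem mem_image {X Y : Locale.{u}} (f : X ⟶ Y) (V : Y) :
    V ∈ image f ↔ ∃ U, direct f U = V := by
  constructor
  · rintro ⟨W, hW⟩
    exact ⟨_, hW⟩
  · rintro ⟨U, rfl⟩
    exact ⟨direct f U, (gc_inv_direct f).u_l_u_eq_u U⟩

/-- The equaliser of two maps of locales, as a sublocale: the elements which are saturated for
the relation identifying `f⁻¹ V` with `g⁻¹ V` for all `V`. -/
def equaliser {X Y : Locale.{u}} (f g : X ⟶ Y) : Sublocale X where
  carrier := {s | ∀ (V : Y) (c : X), inv f V ⊓ c ≤ s ↔ inv g V ⊓ c ≤ s}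
  sInf_mem' := by
    intro S hS V c
    rw [le_sInf_iff, le_sInf_iff]
    exact forall₂_congr fun s hs => hS hs V c
  himp_mem' := by
    intro a b hb V c
    rw [le_himp_iff, le_himp_iff, inf_assoc, inf_assoc]
    exact hb V (c ⊓ a)

theorem equaliser_condition {X Y : Locale.{u}} (f g : X ⟶ Y) :
    incl (equaliser f g) ≫ f = incl (equaliser f g) ≫ g := by
  refine hom_ext fun V => ?_
  change (equaliser f g).restrict (inv f V) = (equaliser f g).restrict (inv g V)
  refine eq_of_forall_ge_iff fun s => ?_
  rw [(equaliser f g).giRestrict.gc.le_iff_le, (equaliser f g).giRestrict.gc.le_iff_le]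
  simpa using s.2 V ⊤

theorem incl_mono {X : Locale.{u}} (S : Sublocale X) : Mono (incl S) := by
  constructor
  intro Z f g h
  refine hom_ext fun V => ?_
  have hV : ∀ W : X, inv f (S.restrict W) = inv g (S.restrict W) := fun W =>
    show inv (f ≫ incl S) W = inv (g ≫ incl S) W by rw [h]
  have e : S.restrict (Subtype.val (p := (· ∈ S)) V) = V := Sublocale.restrict_of_mem _
  rw [← e]
  exact hV _

theorem exists_equaliser_lift {X Y Z : Locale.{u}} (f g : X ⟶ Y) (k : Z ⟶ X)
    (w : k ≫ f = k ≫ g) : ∃ l : Z ⟶ of (equaliser f g), l ≫ incl (equaliser f g) = k := by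
  have hw : ∀ V, inv k (inv f V) = inv k (inv g V) := fun V =>
    show inv (k ≫ f) V = inv (k ≫ g) V by rw [w]
  have hmem : ∀ U, direct k U ∈ equaliser f g := by
    intro U V c
    rw [← (gc_inv_direct k).le_iff_le, ← (gc_inv_direct k).le_iff_le, map_inf, map_inf, hw]
  have gc : GaloisConnection (fun s : equaliser f g => inv k (s : X))
      (fun U => (⟨direct k U, hmem U⟩ : equaliser f g)) := fun s U => gc_inv_direct k (s : X) U
  let h : FrameHom (equaliser f g) Z :=
    { toFun := fun s => inv k (s : X)
      map_inf' := fun a b => by rw [Sublocale.coe_inf, map_inf]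
      map_top' := map_top (inv k)
      map_sSup' := fun S => by rw [sSup_image]; exact gc.l_sSup }
  refine ⟨ofFrameHom (Y := of (equaliser f g)) h, hom_ext fun V => ?_⟩
  change inv k ((equaliser f g).restrict V : X) = inv k V
  refine eq_of_forall_ge_iff fun U => ?_
  rw [gc_inv_direct k _ U, gc_inv_direct k _ U]
  exact (equaliser f g).giRestrict.gc.le_iff_le (b := ⟨_, hmem U⟩)

/-! ## Products and pullbacks -/

/-- The product of two locales. -/
def prod (X Y : Locale.{u}) : Locale.{u} :=
  of (FrameCoprod X Y)

/-- The first product projection. -/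
def fst (X Y : Locale.{u}) : prod X Y ⟶ X :=
  ofFrameHom (X := prod X Y) FrameCoprod.inl

/-- The second product projection. -/
def snd (X Y : Locale.{u}) : prod X Y ⟶ Y :=
  ofFrameHom (X := prod X Y) FrameCoprod.inr

/-- The pairing `(f, g) : Z ⟶ X × Y`. -/
def pair {X Y Z : Locale.{u}} (f : Z ⟶ X) (g : Z ⟶ Y) : Z ⟶ prod X Y :=
  ofFrameHom (Y := prod X Y) (FrameCoprod.copair (inv f) (inv g))

@[simp] theorem pair_fst {X Y Z : Locale.{u}} (f : Z ⟶ X) (g : Z ⟶ Y) :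
    pair f g ≫ fst X Y = f :=
  hom_ext fun x => FrameCoprod.copair_inl (inv f) (inv g) x

@[simp] theorem pair_snd {X Y Z : Locale.{u}} (f : Z ⟶ X) (g : Z ⟶ Y) :
    pair f g ≫ snd X Y = g :=
  hom_ext fun y => FrameCoprod.copair_inr (inv f) (inv g) y

theorem prod_hom_ext {X Y Z : Locale.{u}} {f g : Z ⟶ prod X Y}
    (h1 : f ≫ fst X Y = g ≫ fst X Y) (h2 : f ≫ snd X Y = g ≫ snd X Y) : f = g := by
  have : inv f = inv g := FrameCoprod.hom_ext
    (fun x => show inv (f ≫ fst X Y) x = inv (g ≫ fst X Y) x by rw [h1])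
    (fun y => show inv (f ≫ snd X Y) y = inv (g ≫ snd X Y) y by rw [h2])
  exact hom_ext fun V => by rw [this]

/-- `prod X Y` is a product of `X` and `Y` in the category of locales. -/
def prodIsLimit (X Y : Locale.{u}) : IsLimit (BinaryFan.mk (fst X Y) (snd X Y)) :=
  BinaryFan.isLimitMk (fun s => pair s.fst s.snd) (fun s => pair_fst s.fst s.snd)
    (fun s => pair_snd s.fst s.snd)
    (fun s m h1 h2 => prod_hom_ext (by rw [h1]; exact (pair_fst s.fst s.snd).symm)
      (by rw [h2]; exact (pair_snd s.fst s.snd).symm))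

/-- The pullback `X ×_Z Y` of `f : X ⟶ Z` and `g : Y ⟶ Z`, as a sublocale of `X × Y`. -/
def pull {X Y Z : Locale.{u}} (f : X ⟶ Z) (g : Y ⟶ Z) : Sublocale (prod X Y) :=
  equaliser (fst X Y ≫ f) (snd X Y ≫ g)

/-- The first pullback projection. -/
def pullFst {X Y Z : Locale.{u}} (f : X ⟶ Z) (g : Y ⟶ Z) : of (pull f g) ⟶ X :=
  incl (pull f g) ≫ fst X Y

/-- The second pullback projection. -/
def pullSnd {X Y Z : Locale.{u}} (f : X ⟶ Z) (g : Y ⟶ Z) : of (pull f g) ⟶ Y :=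
  incl (pull f g) ≫ snd X Y

theorem pull_isPullback {X Y Z : Locale.{u}} (f : X ⟶ Z) (g : Y ⟶ Z) :
    IsPullback (pullFst f g) (pullSnd f g) f g := by
  refine ⟨⟨?_⟩, ⟨?_⟩⟩
  · simp only [pullFst, pullSnd, Category.assoc]
    exact equaliser_condition (fst X Y ≫ f) (snd X Y ≫ g)
  · have ex : ∀ s : PullbackCone f g, ∃ l : s.pt ⟶ of (pull f g),
        l ≫ incl (pull f g) = pair s.fst s.snd := fun s =>
      exists_equaliser_lift _ _ _ (by
        rw [← Category.assoc, ← Category.assoc, pair_fst, pair_snd]; exact s.condition)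
    refine PullbackCone.IsLimit.mk _ (fun s => (ex s).choose) ?_ ?_ ?_
    · intro s
      rw [pullFst, ← Category.assoc, (ex s).choose_spec, pair_fst]
    · intro s
      rw [pullSnd, ← Category.assoc, (ex s).choose_spec, pair_snd]
    · intro s m h1 h2
      have := incl_mono (pull f g)
      rw [← cancel_mono (incl (pull f g)), (ex s).choose_spec]
      refine prod_hom_ext ?_ ?_
      · rw [pair_fst, ← h1, pullFst, Category.assoc]
      · rw [pair_snd, ← h2, pullSnd, Category.assoc]

/-! ## Strong density and weak closedness -/

/-- The frame map `𝒪 1 → 𝒪 X` of the unique map from `X` to the terminal locale `1`, whose frame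
of opens `𝒪 1` is the frame of truth values. -/
def truth (X : Locale.{u}) : FrameHom Prop X where
  toFun p := ⨆ _ : p, ⊤
  map_inf' p q := by
    by_cases hp : p <;> by_cases hq : q <;> simp [hp, hq]
  map_top' := by simp
  map_sSup' s := by
    apply le_antisymm
    · refine iSup_le fun h => ?_
      obtain ⟨p, hp, h⟩ := (sSup_Prop_eq ▸ h : ∃ p ∈ s, p)
      exact le_sSup_of_le ⟨p, hp, rfl⟩ (le_iSup (fun _ : p => (⊤ : X)) h)
    · refine sSup_le ?_
      rintro _ ⟨p, hp, rfl⟩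
      exact iSup_le fun h => le_iSup (fun _ : sSup s => (⊤ : X)) (le_sSup hp h)

theorem eq_truth (X : Locale.{u}) (h : FrameHom Prop X) : h = truth X := by
  ext p
  by_cases hp : p
  · have e : p = ⊤ := by simpa using hp
    rw [e, map_top, map_top]
  · have e : p = ⊥ := by simpa using hp
    rw [e, map_bot, map_bot]

/-- A map of locales `f : X ⟶ Y` is strongly dense if `f_* (!_X⁻¹ p) ≤ !_Y⁻¹ p` for every truth
value `p`. -/
def StronglyDense {X Y : Locale.{u}} (f : X ⟶ Y) : Prop :=
  ∀ p : Prop, direct f (truth X p) ≤ truth Y p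

/-- A sublocale `A` of `X` is weakly closed if every strongly dense inclusion of `A` in a
sublocale `B` of `X` is an isomorphism. -/
def WeaklyClosed {X : Locale.{u}} (A : Sublocale X) : Prop :=
  ∀ (B : Sublocale X) (h : A ≤ B), StronglyDense (inclusion h) → IsIso (inclusion h)

/-! ## Localic relations -/

/-- A localic relation on `X` is a sublocale of `X × X`. -/
abbrev Relation (X : Locale.{u}) : Type u :=
  Sublocale (prod X X)

namespace Relation

variable {X : Locale.{u}}

/-- The source map of a localic relation. -/
def source (R : Relation X) : of R ⟶ X :=
  incl R ≫ fst X X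

/-- The target map of a localic relation. -/
def target (R : Relation X) : of R ⟶ X :=
  incl R ≫ snd X X

/-- A localic relation has open cones if its source and target maps are open. -/
def HasOpenCones (R : Relation X) : Prop :=
  IsOpenMap R.source ∧ IsOpenMap R.target

/-- The diagonal relation: the image of the diagonal map `X ⟶ X × X`. -/
def diagonal (X : Locale.{u}) : Relation X :=
  image (pair (𝟙 X) (𝟙 X))

/-- The opposite relation, whose source and target are the target and source of `R`. -/
def opposite (R : Relation X) : Relation X :=
  image (pair R.target R.source)

/-- The composite relation: the image in `X × X` of the pullback of the target map of `R` along
the source map of `Q`. -/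
def comp (R Q : Relation X) : Relation X :=
  image (pair (pullFst R.target Q.source ≫ R.source) (pullSnd R.target Q.source ≫ Q.target))

/-- A localic equivalence relation: reflexive, symmetric and transitive. -/
structure IsEquivalence (R : Relation X) : Prop where
  refl : diagonal X ≤ R
  symm : R = R.opposite
  trans : R.comp R ≤ R

/-- `q` is the quotient map `X ⟶ X / R` of `R`: a coequaliser of its source and target maps. -/
def IsQuotientMap (R : Relation X) {Q : Locale.{u}} (q : X ⟶ Q) : Prop :=
  ∃ w : R.source ≫ q = R.target ≫ q, Nonempty (IsColimit (Cofork.ofπ q w))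

end Relation

end Locale

end


/-! Let `s, t : G ⇉ X` be reflexive, symmetric and transitive, with `t` open, and let `q` be its
coequaliser. Beck–Chevalley for `G ×_X G`, together with transitivity, shows that `t_! (s⁻¹ U)` is
invariant, so it is `q⁻¹ B` for some open `B` of the quotient; by reflexivity it contains `U`.
If `s⁻¹ U ⊓ t⁻¹ V ≤ !⁻¹ p`, Frobenius reciprocity gives `q⁻¹ B ⊓ V ≤ !⁻¹ p`. In the kernel pair of
`q` the pullbacks of `q⁻¹ B` along the two projections agree, so the rectangle on `U` and `V` is
itself below `!⁻¹ p` there. Hence `G` is strongly dense in the kernel pair of `q`, and weak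
closedness turns strong density into an isomorphism. -/

noncomputable section

namespace FrameCoprod

variable {L M : Type u} [Order.Frame L] [Order.Frame M]

theorem le_iff_forall_rect_le {C D : FrameCoprod L M} :
    C ≤ D ↔ ∀ x y, rect x y ≤ C → rect x y ≤ D := by
  refine ⟨fun h x y hC => hC.trans h, fun h p hp => ?_⟩
  exact (rect_le_iff p.1 p.2 D).1 (h p.1 p.2 ((rect_le_iff p.1 p.2 C).2 hp))

theorem inf_le_iff_forall_inf_rect_le {B C D : FrameCoprod L M} :
    B ⊓ C ≤ D ↔ ∀ x y, rect x y ≤ C → B ⊓ rect x y ≤ D := by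
  simp only [← le_himp_iff']
  exact le_iff_forall_rect_le

/-- For `φ ⊣ ψ`, the value at `z` of the right adjoint of the map `L ⊗ M → M` which preserves
joins and sends `x ⊗ y` to `φ x ⊓ y`. -/
def infAdj {φ : L → M} {ψ : M → L} (gc : GaloisConnection φ ψ) (z : M) : FrameCoprod L M :=
  ⟨⟨{p | φ p.1 ⊓ p.2 ≤ z}, fun _ _ hqp hp => (inf_le_inf (gc.monotone_l hqp.1) hqp.2).trans hp⟩,
    fun _ _ hS => le_himp_iff.1 <| (gc _ _).2 <| sSup_le fun x hx =>
      (gc _ _).1 (le_himp_iff.2 (hS x hx)),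
    fun _ _ hT => le_himp_iff'.1 <| sSup_le fun y hy => le_himp_iff'.2 (hT y hy)⟩

theorem rect_le_infAdj_iff {φ : L → M} {ψ : M → L} (gc : GaloisConnection φ ψ) {x : L} {y z : M} :
    rect x y ≤ infAdj gc z ↔ φ x ⊓ y ≤ z :=
  rect_le_iff x y _

end FrameCoprod

/-! ## Coequalisers -/

/-- The equaliser of two frame maps: the subframe of the elements on which they agree. -/
def FrameEqLocus {L M : Type u} [Order.Frame L] [Order.Frame M] (g h : FrameHom L M) : Type u :=
  {x : L // g x = h x}

namespace FrameEqLocus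

variable {L M N : Type u} [Order.Frame L] [Order.Frame M] [Order.Frame N] (g h : FrameHom L M)

instance : PartialOrder (FrameEqLocus g h) :=
  inferInstanceAs (PartialOrder {x : L // g x = h x})

instance : SupSet (FrameEqLocus g h) where
  sSup S := ⟨sSup (Subtype.val '' S), by
    rw [map_sSup, map_sSup]
    refine congrArg sSup (Set.image_congr ?_)
    rintro _ ⟨x, -, rfl⟩
    exact x.2⟩

theorem isLUB_sSup (S : Set (FrameEqLocus g h)) : IsLUB S (sSup S) := by
  constructor
  · intro x hx
    exact le_sSup (a := x.1) ⟨x, hx, rfl⟩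
  · intro y hy
    refine sSup_le (α := L) ?_
    rintro _ ⟨x, hx, rfl⟩
    exact hy hx

instance : CompleteLattice (FrameEqLocus g h) where
  __ := completeLatticeOfSup (FrameEqLocus g h) (isLUB_sSup g h)
  inf x y := ⟨x.1 ⊓ y.1, by rw [map_inf, map_inf, x.2, y.2]⟩
  inf_le_left x y := inf_le_left (a := x.1) (b := y.1)
  inf_le_right x y := inf_le_right (a := x.1) (b := y.1)
  le_inf _ _ _ hy hz := le_inf (α := L) hy hz
  top := ⟨⊤, by rw [map_top, map_top]⟩
  le_top x := le_top (a := x.1)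

instance : Order.Frame (FrameEqLocus g h) :=
  Order.Frame.ofMinimalAxioms
    { inf_sSup_le_iSup_inf := fun a S => by
        change a.1 ⊓ sSup (Subtype.val '' S) ≤ (⨆ b ∈ S, a ⊓ b).1
        rw [inf_sSup_eq]
        refine iSup₂_le ?_
        rintro _ ⟨b, hb, rfl⟩
        exact (le_iSup₂_of_le b hb le_rfl : a ⊓ b ≤ ⨆ b ∈ S, a ⊓ b) }

/-- The inclusion of the equaliser of two frame maps. -/
def subtype : FrameHom (FrameEqLocus g h) L where
  toFun := Subtype.val
  map_inf' _ _ := rfl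
  map_top' := rfl
  map_sSup' _ := rfl

variable {g h}

/-- The factorisation through the equaliser of a frame map which equalises `g` and `h`. -/
def lift (k : FrameHom N L) (hk : ∀ n, g (k n) = h (k n)) : FrameHom N (FrameEqLocus g h) where
  toFun n := ⟨k n, hk n⟩
  map_inf' a b := Subtype.ext (map_inf k a b)
  map_top' := Subtype.ext (map_top k)
  map_sSup' S := Subtype.ext <| (map_sSup k S).trans <| congrArg sSup
    (Set.image_image Subtype.val (fun n => (⟨k n, hk n⟩ : FrameEqLocus g h)) S).symm

end FrameEqLocus

namespace LocalicQuotient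

open Locale hiding inv image pair prod

variable {W X Y Z : Locale.{u}}

theorem inv_inv_of_comp_eq {f : X ⟶ Y} {g : Y ⟶ Z} {k : X ⟶ Z} (h : f ≫ g = k) (V : Z) :
    Locale.inv f (Locale.inv g V) = Locale.inv k V :=
  congrArg (fun l => Locale.inv l V) h

theorem inv_inv_eq_inv_inv {f : W ⟶ X} {g : X ⟶ Z} {f' : W ⟶ Y} {g' : Y ⟶ Z}
    (h : f ≫ g = f' ≫ g') (V : Z) :
    Locale.inv f (Locale.inv g V) = Locale.inv f' (Locale.inv g' V) :=
  inv_inv_of_comp_eq h V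

theorem inv_mono (f : X ⟶ Y) : Monotone (Locale.inv f) :=
  OrderHomClass.mono (Locale.inv f)

/-- The coequaliser of two maps of locales, whose opens are those with equal inverse images. -/
def coequaliser (f g : X ⟶ Y) : Locale.{u} :=
  of (FrameEqLocus (Locale.inv f) (Locale.inv g))

/-- The universal map to the coequaliser, whose frame map is the inclusion of a subframe. -/
def coequaliserMap (f g : X ⟶ Y) : Y ⟶ coequaliser f g :=
  ofFrameHom (Y := coequaliser f g) (FrameEqLocus.subtype (Locale.inv f) (Locale.inv g))

theorem coequaliser_condition (f g : X ⟶ Y) :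
    f ≫ coequaliserMap f g = g ≫ coequaliserMap f g :=
  Locale.hom_ext fun V => Subtype.property (p := fun x => Locale.inv f x = Locale.inv g x) V

/-- The universal property of the coequaliser. -/
def coequaliserIsColimit (f g : X ⟶ Y) :
    IsColimit (Cofork.ofπ (coequaliserMap f g) (coequaliser_condition f g)) :=
  Cofork.IsColimit.mk _
    (fun c => ofFrameHom (X := coequaliser f g) (FrameEqLocus.lift (Locale.inv c.π)
      (inv_inv_eq_inv_inv c.condition)))
    (fun _ => rfl)
    (fun _ _ hm => Locale.hom_ext fun V => Subtype.ext (inv_inv_of_comp_eq hm V))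

theorem exists_inv_eq_of_isColimit {f g : X ⟶ Y} {q : Y ⟶ Z} {w : f ≫ q = g ≫ q}
    (hq : IsColimit (Cofork.ofπ q w)) {A : Y} (hA : Locale.inv f A = Locale.inv g A) :
    ∃ B : Z, Locale.inv q B = A := by
  obtain ⟨d, hd⟩ := Cofork.IsColimit.desc' hq (coequaliserMap f g) (coequaliser_condition f g)
  let A' : coequaliser f g := (⟨A, hA⟩ : FrameEqLocus (Locale.inv f) (Locale.inv g))
  exact ⟨Locale.inv d A', inv_inv_of_comp_eq hd A'⟩

/-! ## Sublocales -/

theorem restrict_le_iff (S : Sublocale X) {V : X} {D : S} : S.restrict V ≤ D ↔ V ≤ (D : X) :=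
  S.giRestrict.gc.le_iff_le

theorem exists_comp_incl_eq {S : Sublocale X} {k : Z ⟶ X} (hk : Locale.image k ≤ S) :
    ∃ l : Z ⟶ of S, l ≫ incl S = k := by
  have direct_mem (U : Z) : direct k U ∈ S := hk ((mem_image k _).2 ⟨U, rfl⟩)
  have gc : GaloisConnection (fun D : S => Locale.inv k (D : X))
      (fun U => (⟨direct k U, direct_mem U⟩ : S)) := fun D U => gc_inv_direct k (D : X) U
  let l : FrameHom S Z :=
    { toFun := fun D => Locale.inv k (D : X)
      map_inf' := fun D E => by rw [Sublocale.coe_inf, map_inf]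
      map_top' := map_top (Locale.inv k)
      map_sSup' := fun B => by rw [sSup_image]; exact gc.l_sSup }
  refine ⟨ofFrameHom (Y := of S) l, Locale.hom_ext fun V => eq_of_forall_ge_iff fun U => ?_⟩
  exact (gc _ U).trans ((restrict_le_iff S).trans (gc_inv_direct k V U).symm)

theorem le_equaliser {S : Sublocale X} {f g : X ⟶ Y} (h : incl S ≫ f = incl S ≫ g) :
    S ≤ equaliser f g := by
  intro D hD V C
  have restrict_inv : S.restrict (Locale.inv f V) = S.restrict (Locale.inv g V) :=
    inv_inv_eq_inv_inv h V
  change _ ≤ ((⟨D, hD⟩ : S) : X) ↔ _ ≤ ((⟨D, hD⟩ : S) : X)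
  rw [← restrict_le_iff, ← restrict_le_iff, map_inf, map_inf, restrict_inv]

theorem inclusion_comp_pullFst {S : Sublocale (Locale.prod X Y)} {f : X ⟶ Z} {g : Y ⟶ Z}
    (h : S ≤ pull f g) : inclusion h ≫ pullFst f g = incl S ≫ fst X Y := by
  rw [pullFst, ← Category.assoc, inclusion_incl]

theorem inclusion_comp_pullSnd {S : Sublocale (Locale.prod X Y)} {f : X ⟶ Z} {g : Y ⟶ Z}
    (h : S ≤ pull f g) : inclusion h ≫ pullSnd f g = incl S ≫ snd X Y := by
  rw [pullSnd, ← Category.assoc, inclusion_incl]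

theorem isPullback_of_isIso_inclusion {S : Sublocale (Locale.prod X Y)} {f : X ⟶ Z} {g : Y ⟶ Z}
    (h : S ≤ pull f g) [IsIso (inclusion h)] :
    IsPullback (incl S ≫ fst X Y) (incl S ≫ snd X Y) f g :=
  (pull_isPullback f g).of_iso' (asIso (inclusion h)) (Iso.refl X) (Iso.refl Y) (Iso.refl Z)
    (by simpa using inclusion_comp_pullFst h) (by simpa using inclusion_comp_pullSnd h)
    (by simp) (by simp)

theorem restrict_rect (S : Sublocale (Locale.prod X Y)) (U : X) (V : Y) :
    S.restrict (FrameCoprod.rect U V) =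
      Locale.inv (incl S ≫ fst X Y) U ⊓ Locale.inv (incl S ≫ snd X Y) V := by
  rw [← FrameCoprod.inl_inf_inr]
  exact S.restrict.map_inf' _ _

/-! ## Strong density -/

theorem inv_truth (f : X ⟶ Y) (p : Prop) : Locale.inv f (truth Y p) = truth X p :=
  DFunLike.congr_fun (eq_truth X ((Locale.inv f).comp (truth Y))) p

theorem stronglyDense_iff {f : X ⟶ Y} :
    StronglyDense f ↔ ∀ (p : Prop) (V : Y), Locale.inv f V ≤ truth X p → V ≤ truth Y p :=
  forall_congr' fun _ => sSup_le_iff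

theorem stronglyDense_of_forall_rect {T : Sublocale (Locale.prod X Y)} {k : Z ⟶ of T}
    (h : ∀ (p : Prop) (U : X) (V : Y),
      Locale.inv (k ≫ incl T ≫ fst X Y) U ⊓ Locale.inv (k ≫ incl T ≫ snd X Y) V ≤ truth Z p →
        Locale.inv (incl T ≫ fst X Y) U ⊓ Locale.inv (incl T ≫ snd X Y) V ≤ truth (of T) p) :
    StronglyDense k := by
  refine stronglyDense_iff.2 fun p (D : T) hD => ?_
  refine FrameCoprod.le_iff_forall_rect_le.2 fun U V hUV => ?_
  refine (restrict_le_iff T (D := truth (of T) p)).1 ?_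
  rw [restrict_rect]
  refine h p U V ?_
  calc Locale.inv (k ≫ incl T ≫ fst X Y) U ⊓ Locale.inv (k ≫ incl T ≫ snd X Y) V
      = Locale.inv k (T.restrict (FrameCoprod.rect U V)) := by
        rw [restrict_rect]
        exact (map_inf (Locale.inv k) _ _).symm
    _ ≤ Locale.inv k D := inv_mono k ((restrict_le_iff T).2 hUV)
    _ ≤ truth Z p := hD

/-! ## Open maps and the Beck–Chevalley condition -/

/-- The left adjoint `f_!` of `f⁻¹`, for an open map `f`. -/
def shriek {f : X ⟶ Y} (hf : IsOpenMap f) : X → Y :=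
  hf.choose

theorem gc_shriek_inv {f : X ⟶ Y} (hf : IsOpenMap f) :
    GaloisConnection (shriek hf) (Locale.inv f) :=
  hf.choose_spec.1

theorem shriek_inf_inv {f : X ⟶ Y} (hf : IsOpenMap f) (U : X) (V : Y) :
    shriek hf (U ⊓ Locale.inv f V) = shriek hf U ⊓ V :=
  hf.choose_spec.2 U V

theorem mem_pull_of_forall_rect {f : X ⟶ Z} {g : Y ⟶ Z} {D : FrameCoprod X Y}
    (h : ∀ (V : Z) (x : X) (y : Y), FrameCoprod.rect (Locale.inv f V ⊓ x) y ≤ D ↔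
      FrameCoprod.rect x (Locale.inv g V ⊓ y) ≤ D) :
    (D : Locale.prod X Y) ∈ pull f g := by
  intro V C
  refine FrameCoprod.inf_le_iff_forall_inf_rect_le.trans
    (Iff.trans ?_ FrameCoprod.inf_le_iff_forall_inf_rect_le.symm)
  refine forall₃_congr fun x y _ => ?_
  change FrameCoprod.rect (Locale.inv f V) ⊤ ⊓ FrameCoprod.rect x y ≤ D ↔
    FrameCoprod.rect ⊤ (Locale.inv g V) ⊓ FrameCoprod.rect x y ≤ D
  rw [FrameCoprod.rect_inf_rect, FrameCoprod.rect_inf_rect, top_inf_eq, top_inf_eq]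
  exact h V x y

theorem inv_pullFst_le_inv_pullSnd_iff {f : X ⟶ Z} (hf : IsOpenMap f) (g : Y ⟶ Z) {x : X} {y : Y} :
    Locale.inv (pullFst f g) x ≤ Locale.inv (pullSnd f g) y ↔
      Locale.inv g (shriek hf x) ≤ y := by
  have gc : GaloisConnection (Locale.inv g ∘ shriek hf) (Locale.inv f ∘ direct g) :=
    (gc_shriek_inv hf).compose (gc_inv_direct g)
  constructor
  · intro h
    have mem_pull : (FrameCoprod.infAdj gc y : Locale.prod X Y) ∈ pull f g :=
      mem_pull_of_forall_rect fun V a b => by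
        rw [FrameCoprod.rect_le_infAdj_iff, FrameCoprod.rect_le_infAdj_iff, Function.comp_apply,
          Function.comp_apply, inf_comm _ a, shriek_inf_inv, map_inf, inf_assoc]
    have snd_le : Locale.inv (pullSnd f g) y ≤ (⟨_, mem_pull⟩ : pull f g) :=
      (restrict_le_iff (pull f g)).2 ((FrameCoprod.rect_le_infAdj_iff gc).2 inf_le_right)
    have fst_le : FrameCoprod.rect x ⊤ ≤ FrameCoprod.infAdj gc y :=
      (restrict_le_iff (pull f g) (D := ⟨_, mem_pull⟩)).1 (h.trans snd_le)
    simpa only [inf_top_eq, Function.comp_apply] using (FrameCoprod.rect_le_infAdj_iff gc).1 fst_le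
  · intro h
    calc Locale.inv (pullFst f g) x
        ≤ Locale.inv (pullFst f g) (Locale.inv f (shriek hf x)) :=
          inv_mono _ ((gc_shriek_inv hf).le_u_l x)
      _ = Locale.inv (pullSnd f g) (Locale.inv g (shriek hf x)) :=
          inv_inv_eq_inv_inv (pull_isPullback f g).w _
      _ ≤ Locale.inv (pullSnd f g) y := inv_mono _ h

/-! ## Pseudo-equivalence relations -/

/-- A parallel pair of maps of locales is a pseudo-equivalence relation if it is reflexive,
symmetric and transitive. The pair need not be jointly monic, so the three witnesses need not be
unique. -/
structure IsPseudoEquivalence (s t : W ⟶ X) : Prop where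
  refl : ∃ d : X ⟶ W, d ≫ s = 𝟙 X ∧ d ≫ t = 𝟙 X
  symm : ∃ i : W ⟶ W, i ≫ s = t ∧ i ≫ t = s
  trans : ∃ m : of (pull t s) ⟶ W, m ≫ s = pullFst t s ≫ s ∧ m ≫ t = pullSnd t s ≫ t

theorem isPseudoEquivalence_source_target {R : Relation X} (hR : R.IsEquivalence) :
    IsPseudoEquivalence R.source R.target := by
  have exists_lift {Z : Locale.{u}} {f g : Z ⟶ X} (h : Locale.image (Locale.pair f g) ≤ R) :
      ∃ l : Z ⟶ of R, l ≫ R.source = f ∧ l ≫ R.target = g := by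
    obtain ⟨l, hl⟩ := exists_comp_incl_eq h
    refine ⟨l, ?_, ?_⟩
    · rw [Relation.source, reassoc_of% hl, pair_fst]
    · rw [Relation.target, reassoc_of% hl, pair_snd]
  exact ⟨exists_lift hR.refl, exists_lift hR.symm.ge, exists_lift hR.trans⟩

/-- The saturation `t_! (s⁻¹ U)` of an open `U` with respect to a parallel pair `s, t`. -/
def saturation (s : W ⟶ X) {t : W ⟶ X} (ht : IsOpenMap t) (U : X) : X :=
  shriek ht (Locale.inv s U)

namespace IsPseudoEquivalence

variable {s t : W ⟶ X} (h : IsPseudoEquivalence s t) (ht : IsOpenMap t)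
include h

theorem le_saturation (U : X) : U ≤ saturation s ht U := by
  obtain ⟨d, hds, hdt⟩ := h.refl
  calc U = Locale.inv d (Locale.inv s U) := (inv_inv_of_comp_eq hds U).symm
    _ ≤ Locale.inv d (Locale.inv t (saturation s ht U)) :=
        inv_mono d ((gc_shriek_inv ht).le_u_l _)
    _ = saturation s ht U := inv_inv_of_comp_eq hdt _

theorem inv_saturation_le (U : X) :
    Locale.inv s (saturation s ht U) ≤ Locale.inv t (saturation s ht U) := by
  obtain ⟨m, hms, hmt⟩ := h.trans
  refine (inv_pullFst_le_inv_pullSnd_iff ht s).1 ?_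
  calc Locale.inv (pullFst t s) (Locale.inv s U)
      = Locale.inv m (Locale.inv s U) :=
        (inv_inv_eq_inv_inv hms U).symm
    _ ≤ Locale.inv m (Locale.inv t (saturation s ht U)) :=
        inv_mono m ((gc_shriek_inv ht).le_u_l _)
    _ = Locale.inv (pullSnd t s) (Locale.inv t (saturation s ht U)) :=
        inv_inv_eq_inv_inv hmt _

theorem inv_eq_of_inv_le {U : X} (hU : Locale.inv s U ≤ Locale.inv t U) :
    Locale.inv s U = Locale.inv t U := by
  obtain ⟨i, his, hit⟩ := h.symm
  refine le_antisymm hU ?_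
  calc Locale.inv t U = Locale.inv i (Locale.inv s U) := (inv_inv_of_comp_eq his U).symm
    _ ≤ Locale.inv i (Locale.inv t U) := inv_mono i hU
    _ = Locale.inv s U := inv_inv_of_comp_eq hit U

theorem exists_inv_eq_saturation {q : X ⟶ Z} {w : s ≫ q = t ≫ q}
    (hq : IsColimit (Cofork.ofπ q w)) (U : X) : ∃ B : Z, Locale.inv q B = saturation s ht U :=
  exists_inv_eq_of_isColimit hq (h.inv_eq_of_inv_le (h.inv_saturation_le ht U))

include ht in
theorem stronglyDense_of_isColimit {q : X ⟶ Z} {w : s ≫ q = t ≫ q}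
    (hq : IsColimit (Cofork.ofπ q w)) {k : W ⟶ of (pull q q)} (hks : k ≫ pullFst q q = s)
    (hkt : k ≫ pullSnd q q = t) : StronglyDense k := by
  refine stronglyDense_of_forall_rect fun p U V hUV => ?_
  change Locale.inv (k ≫ pullFst q q) U ⊓ Locale.inv (k ≫ pullSnd q q) V ≤ _ at hUV
  change Locale.inv (pullFst q q) U ⊓ Locale.inv (pullSnd q q) V ≤ _
  rw [hks, hkt] at hUV
  obtain ⟨B, hB⟩ := h.exists_inv_eq_saturation ht hq U
  have saturation_inf_le : saturation s ht U ⊓ V ≤ truth X p := by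
    rw [saturation, ← shriek_inf_inv]
    exact (gc_shriek_inv ht _ _).2 (hUV.trans (inv_truth t p).ge)
  have inv_fst_eq_inv_snd : Locale.inv (pullFst q q) (Locale.inv q B) =
      Locale.inv (pullSnd q q) (Locale.inv q B) :=
    inv_inv_eq_inv_inv (pull_isPullback q q).w B
  calc Locale.inv (pullFst q q) U ⊓ Locale.inv (pullSnd q q) V
      ≤ Locale.inv (pullFst q q) (Locale.inv q B) ⊓ Locale.inv (pullSnd q q) V :=
        inf_le_inf_right _ (inv_mono _ ((h.le_saturation ht U).trans hB.ge))
    _ = Locale.inv (pullSnd q q) (saturation s ht U ⊓ V) := by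
        rw [inv_fst_eq_inv_snd, hB, map_inf]
    _ ≤ Locale.inv (pullSnd q q) (truth X p) := inv_mono _ saturation_inf_le
    _ = truth (of (pull q q)) p := inv_truth _ p

end IsPseudoEquivalence

theorem exists_isQuotientMap (R : Relation X) : ∃ (Q : Locale.{u}) (q : X ⟶ Q), R.IsQuotientMap q :=
  ⟨coequaliser R.source R.target, coequaliserMap R.source R.target, coequaliser_condition _ _,
    ⟨coequaliserIsColimit _ _⟩⟩

theorem le_pull_of_source_comp_eq {R : Relation X} {q : X ⟶ Z} (w : R.source ≫ q = R.target ≫ q) :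
    R ≤ pull q q :=
  le_equaliser (by simpa only [Relation.source, Relation.target, Category.assoc] using w)

end LocalicQuotient

end

theorem mainTheorem4 (X : Locale.{u}) (R : Locale.Relation X) (hequiv : R.IsEquivalence)
    (hopen : R.HasOpenCones) (hclosed : Locale.WeaklyClosed R) :
    (∃ (Q : Locale.{u}) (q : X ⟶ Q), R.IsQuotientMap q) ∧
      ∀ (Q : Locale.{u}) (q : X ⟶ Q), R.IsQuotientMap q → IsKernelPair q R.source R.target := by
  refine ⟨LocalicQuotient.exists_isQuotientMap R, ?_⟩
  rintro Q q ⟨w, ⟨hq⟩⟩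
  have le_pull : R ≤ Locale.pull q q := LocalicQuotient.le_pull_of_source_comp_eq w
  have stronglyDense : Locale.StronglyDense (Locale.inclusion le_pull) :=
    (LocalicQuotient.isPseudoEquivalence_source_target hequiv).stronglyDense_of_isColimit hopen.2 hq
      (LocalicQuotient.inclusion_comp_pullFst le_pull)
      (LocalicQuotient.inclusion_comp_pullSnd le_pull)
  have : IsIso (Locale.inclusion le_pull) := hclosed _ le_pull stronglyDense
  exact LocalicQuotient.isPullback_of_isIso_inclusion le_pull
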